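/- Let $m,s\ge 1$, let $\lambda_i,\mu_i>0$ and $\rho_i=\lambda_i/\mu_i$ $(1\le i\le m)$, $\mu_{\min}=\min_i\mu_i$, $\mu_{\max}=\max_i\mu_i$. Let $\mathbf D\in\mathbf R^{s\times m}$ have rows $\mathbf d_j$, let $\mathbf h\in\mathbf R_+^s$, and let $D^+_{ji}=\max\{D_{ji},0\}$, $D^-_{ji}=\max\{-D_{ji},0\}$ be the entries of $\mathbf D^{\pm}$, with rows $\mathbf d_j^{\pm}$. Let the target set be $\mathcal S=\{\mathbf x:\mathbf 0\le\mathbf x\le\boldsymbol\rho,\ \mathbf D\mathbf x\le\mathbf h\}$ and assume that some $\mathbf x\in\mathcal S$ satisfies $\mathbf D\mathbf x<\mathbf h$ (strictly in every row). Put $H_j=h_j+\mathbf d_j^-\boldsymbol\rho$, $$\tilde{\mathcal S}=\{(\mathbf x,\mathbf y):\mathbf 0\le\mathbf x\le\boldsymbol\rho,\ \mathbf 0\le\mathbf y\le\boldsymbol\rho,\ \mathbf x+\mathbf y\ge\boldsymbol\rho,\ \mathbf D^+\mathbf x+\mathbf D^-\mathbf y\le\mathbf h+\mathbf D^-\boldsymbol\rho\},$$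 let $(\mathbf x^*,\mathbf y^*)$ be any minimizer over $\tilde{\mathcal S}$ of $\max_{1\le j\le s}(\mathbf d_j^+\mathbf x+\mathbf d_j^-\mathbf y)/H_j$, and let $\gamma^*$ be the minimum value. For $\beta>0$ and $0<\varepsilon<\frac14$ let $$\Psi(\mathbf x,\mathbf y)=\sum_{j=1}^s\exp\Bigl(\beta\,\frac{\mathbf d_j^+\mathbf x+\mathbf d_j^-\mathbf y}{H_j}\Bigr),\qquad \Psi^*=\Psi\Bigl(\frac{(1+3\varepsilon)\mu_{\max}}{\mu_{\min}}(\mathbf x^*,\mathbf y^*)\Bigr).$$ Class $i$ requests arrive in independent Poisson streams of rates $\lambda_i$ and need independent $\exp(\mu_i)$ service times. The penalty policy accepts a class $i$ request arriving in state $(\mathbf x,\mathbf y)$ into the original infinite-capacity system if $\partial\Psi/\partial x_i\le\partial\Psi/\partial y_i$ at $(\mathbf x,\mathbf y)$, and otherwise routes it to a fictitious infinite-capacity system, where it stays for an independent $\exp(\mu_i)$ time. Let $\tilde{\mathbf x}(t),\tilde{\mathbf y}(t)\in\mathbf Z_+^m$ be the numbers of requests in the two systems at time $t$; initially the original system is empty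 and the fictitious system holds $\tilde{\mathbf y}(0^-)\in\mathbf Z_+^m$ requests. Suppose that $\beta\,|D_{ji}|\le\varepsilon H_j$ for all $i,j$ (if all $|D_{ji}|\le1$, this follows from $\beta\le\varepsilon\min_jH_j$), that $\mu_{\min}/\mu_{\max}\ge\gamma^*$, and that $\Psi(\mathbf 0,\tilde{\mathbf y}(0^-))\le\Psi^*$. Then, for all $t\ge0$, $\mathbf E[\tilde{\mathbf x}(t)]$ is finite and $$\mathbf d_j\,\mathbf E[\tilde{\mathbf x}(t)]\le h_j+\zeta\,(h_j+\mathbf d_j^-\boldsymbol\rho)+\mathbf d_j^-e^{-\mathbf Mt}(\boldsymbol\rho-\tilde{\mathbf y}(0^-)),\qquad j=1,\dots,s,$$ where $\zeta=\frac{\log s}{\beta}+3\varepsilon$ and $\mathbf M=\mathrm{diag}(\mu_1,\dots,\mu_m)$. -/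

import Mathlib

open MeasureTheory ProbabilityTheory Filter Topology
open scoped NNReal

noncomputable section

namespace PolytopicTarget

/-- Data of the state control problem with `m` request classes and `s` linear constraints:
Poisson arrival rates `lam`, exponential service rates `mu`, and the target constraints
`D x ≤ h`. -/
structure Model (m s : ℕ) where
  lam : Fin m → ℝ
  mu : Fin m → ℝ
  D : Matrix (Fin s) (Fin m) ℝ
  h : Fin s → ℝ

variable {m s : ℕ}

/-- The load `ρ_i = λ_i / μ_i` of class `i`. -/
def Model.load (M : Model m s) (i : Fin m) : ℝ := M.lam i / M.mu i

/-- The positive part `D⁺`. -/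
def Model.Dpos (M : Model m s) (j : Fin s) (i : Fin m) : ℝ := max (M.D j i) 0

/-- The negative part `D⁻`. -/
def Model.Dneg (M : Model m s) (j : Fin s) (i : Fin m) : ℝ := max (-(M.D j i)) 0

/-- The normalizing constant `h_j + d_j⁻ ρ` of constraint `j`. -/
def Model.cap (M : Model m s) (j : Fin s) : ℝ := M.h j + ∑ i, M.Dneg j i * M.load i

/-- The smallest service rate. -/
def Model.muMin (M : Model m s) : ℝ := ⨅ i, M.mu i

/-- The largest service rate. -/
def Model.muMax (M : Model m s) : ℝ := ⨆ i, M.mu i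

/-- The target polytope `{x : 0 ≤ x ≤ ρ, D x ≤ h}`. -/
def Model.targetSet (M : Model m s) : Set (Fin m → ℝ) :=
  {x | (∀ i, 0 ≤ x i ∧ x i ≤ M.load i) ∧ ∀ j, ∑ i, M.D j i * x i ≤ M.h j}

/-- The lifted set of pairs `(x, y)`. The constraint `ρ ≤ x + y` says that the pair accounts for
the whole load; without it the origin would be a member. Every pair `(x, ρ - x)` with `x` in the
target polytope belongs to the lifted set. -/
def Model.liftedSet (M : Model m s) : Set ((Fin m → ℝ) × (Fin m → ℝ)) :=
  {p | (∀ i, 0 ≤ p.1 i ∧ p.1 i ≤ M.load i) ∧ (∀ i, 0 ≤ p.2 i ∧ p.2 i ≤ M.load i) ∧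
    (∀ i, M.load i ≤ p.1 i + p.2 i) ∧
    ∀ j, ∑ i, M.Dpos j i * p.1 i + ∑ i, M.Dneg j i * p.2 i ≤ M.cap j}

/-- The ratio `(d_j⁺ x + d_j⁻ y) / (h_j + d_j⁻ ρ)`. -/
def Model.ratio (M : Model m s) (j : Fin s) (x y : Fin m → ℝ) : ℝ :=
  (∑ i, M.Dpos j i * x i + ∑ i, M.Dneg j i * y i) / M.cap j

/-- The largest ratio over all constraints. -/
def Model.violation (M : Model m s) (p : (Fin m → ℝ) × (Fin m → ℝ)) : ℝ :=
  ⨆ j, M.ratio j p.1 p.2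

/-- The exponential penalty function `Ψ(x, y)` with multiplier `β`. -/
def Model.penalty (M : Model m s) (β : ℝ) (x y : Fin m → ℝ) : ℝ :=
  ∑ j, Real.exp (β * M.ratio j x y)

/-- `Ψ* = Ψ((1 + 3ε) (μ_max / μ_min) (x*, y*))`. -/
def Model.penaltyLevel (M : Model m s) (β ε : ℝ) (p : (Fin m → ℝ) × (Fin m → ℝ)) : ℝ :=
  M.penalty β (((1 + 3 * ε) * M.muMax / M.muMin) • p.1) (((1 + 3 * ε) * M.muMax / M.muMin) • p.2)

/-- The partial derivative `∂Ψ/∂x_i` at `(x, y)`. -/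
def Model.partialX (M : Model m s) (β : ℝ) (i : Fin m) (x y : Fin m → ℝ) : ℝ :=
  deriv (fun u : ℝ => M.penalty β (Function.update x i u) y) (x i)

/-- The partial derivative `∂Ψ/∂y_i` at `(x, y)`. -/
def Model.partialY (M : Model m s) (β : ℝ) (i : Fin m) (x y : Fin m → ℝ) : ℝ :=
  deriv (fun u : ℝ => M.penalty β x (Function.update y i u)) (y i)

/-- States: numbers of class `i` requests in the original and in the fictitious system. -/
abbrev State (m : ℕ) : Type := (Fin m → ℕ) × (Fin m → ℕ)

/-- The penalty policy accepts an arriving class `i` request in state `z`. -/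
def Model.Accepts (M : Model m s) (β : ℝ) (i : Fin m) (z : State m) : Prop :=
  M.partialX β i (fun k => (z.1 k : ℝ)) (fun k => (z.2 k : ℝ)) ≤
    M.partialY β i (fun k => (z.1 k : ℝ)) (fun k => (z.2 k : ℝ))

open Classical in
/-- The state after a class `i` arrival: the request joins the original system if it is accepted
and the fictitious system otherwise. -/
def Model.arrive (M : Model m s) (β : ℝ) (i : Fin m) (z : State m) : State m :=
  if M.Accepts β i z then (Function.update z.1 i (z.1 i + 1), z.2)
  else (z.1, Function.update z.2 i (z.2 i + 1))

/-- The state after a class `i` departure from the original system. -/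
def departX (i : Fin m) (z : State m) : State m := (Function.update z.1 i (z.1 i - 1), z.2)

/-- The state after a class `i` departure from the fictitious system. -/
def departY (i : Fin m) (z : State m) : State m := (z.1, Function.update z.2 i (z.2 i - 1))

/-- The generator of the controlled Markov process: class `i` requests arrive at rate `λ_i` and
are routed by the penalty policy; every class `i` request present in either system departs at
rate `μ_i`. -/
def Model.generator (M : Model m s) (β : ℝ) (f : State m → ℝ) (z : State m) : ℝ :=
  ∑ i, (M.lam i * (f (M.arrive β i z) - f z)
    + M.mu i * (z.1 i : ℝ) * (f (departX i z) - f z)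
    + M.mu i * (z.2 i : ℝ) * (f (departY i z) - f z))

/-- `X` is the state process of the penalty policy, started with the original system empty and
with load `y₀` in the fictitious system: an adapted process with values in the (discrete) state
space and with right-continuous paths with left limits, which solves the martingale problem of
the generator for all finitely supported test functions. -/
structure IsPenaltyProcess (M : Model m s) (β : ℝ) (y₀ : Fin m → ℕ)
    {Ω : Type*} [mΩ : MeasurableSpace Ω] (P : Measure Ω) (ℱ : Filtration ℝ≥0 mΩ)
    (X : ℝ≥0 → Ω → State m) : Prop where
  adapted : ∀ t, Measurable[ℱ t] (X t)
  right_continuous : ∀ ω t, ∀ᶠ u in 𝓝[≥] t, X u ω = X t ω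
  left_limits : ∀ ω t, ∃ z, ∀ᶠ u in 𝓝[<] t, X u ω = z
  initial : ∀ᵐ ω ∂P, X 0 ω = (0, y₀)
  martingale : ∀ f : State m → ℝ, (Function.support f).Finite →
    Martingale (fun (t : ℝ≥0) ω => f (X t ω)
      - ∫ u in (0 : ℝ)..(t : ℝ), M.generator β f (X u.toNNReal ω)) ℱ P

end PolytopicTarget

end

/-!
Along the process the penalty `Ψ` drifts downwards. Its second-order terms are controlled by
`β |D_ji| ≤ ε H_j`, and routing every arrival to the system with the smaller partial derivative does
at least as well as splitting the arrivals in the proportions of the fixed pair `(x*, y*)`, which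
carries the whole load. Convexity then gives `𝓛 Ψ ≤ (1 - ε) μ_min (Ψ* - Ψ)`. Dynkin's formula and
Gronwall's inequality turn this into `E Ψ ≤ Ψ*`, where `Ψ* ≤ s exp (β (1 + 3 ε))` because
`γ* ≤ μ_min / μ_max`, and Jensen's inequality gives `d_j⁺ E x + d_j⁻ E y ≤ (1 + ζ) H_j`.

Finally, `x + y` does not depend on the routing: class by class it is an infinite-server queue,
whose mean is explicit. This eliminates `E y` from the bound.

Dynkin's formula is part of the definition of the process only for finitely supported functions. It
extends to functions of exponential growth, such as `Ψ`, since the total number of requests grows at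
most at the rate `∑ λ_i`, whence all its exponential moments are finite at every time.
-/

namespace PolytopicTarget

section ExpSum

open Matrix

variable {ι κ : Type*} [Fintype ι] [Fintype κ] {A : Matrix ι κ ℝ} {ε : ℝ}

/-- The sum of exponentials `x ↦ ∑ j, exp (A x)_j` of the linear forms given by the rows of `A`.
The penalty function `Ψ` is of this form on the space of pairs `(x, y)`. -/
noncomputable def expSum (A : Matrix ι κ ℝ) (x : κ → ℝ) : ℝ := ∑ j, Real.exp ((A *ᵥ x) j)

/-- The gradient of `expSum A`. -/
noncomputable def expSumGrad (A : Matrix ι κ ℝ) (x : κ → ℝ) : κ → ℝ :=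
  (fun j => Real.exp ((A *ᵥ x) j)) ᵥ* A

lemma exp_mulVec_le_expSum (A : Matrix ι κ ℝ) (x : κ → ℝ) (j : ι) :
    Real.exp ((A *ᵥ x) j) ≤ expSum A x :=
  Finset.single_le_sum (f := fun j => Real.exp ((A *ᵥ x) j)) (fun _ _ => (Real.exp_pos _).le)
    (Finset.mem_univ j)

lemma expSum_nonneg (A : Matrix ι κ ℝ) (x : κ → ℝ) : 0 ≤ expSum A x :=
  Finset.sum_nonneg fun _ _ => (Real.exp_pos _).le

lemma expSum_le_card_mul_exp {x : κ → ℝ} {r : ℝ} (h : ∀ j, (A *ᵥ x) j ≤ r) :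
    expSum A x ≤ Fintype.card ι * Real.exp r := by
  rw [← nsmul_eq_mul, ← Finset.card_univ]
  exact Finset.sum_le_card_nsmul _ _ _ fun j _ => Real.exp_le_exp.2 (h j)

lemma expSumGrad_nonneg (hA : ∀ j k, 0 ≤ A j k) (x : κ → ℝ) (k : κ) : 0 ≤ expSumGrad A x k :=
  Finset.sum_nonneg fun j _ => mul_nonneg (Real.exp_pos _).le (hA j k)

lemma expSumGrad_dotProduct_sub_le (A : Matrix ι κ ℝ) (x x' : κ → ℝ) :
    expSumGrad A x ⬝ᵥ (x' - x) ≤ expSum A x' - expSum A x := by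
  rw [expSumGrad, ← dotProduct_mulVec, mulVec_sub, expSum, expSum, ← Finset.sum_sub_distrib]
  refine Finset.sum_le_sum fun j _ => ?_
  rw [Pi.sub_apply, ← add_sub_cancel ((A *ᵥ x) j) ((A *ᵥ x') j), Real.exp_add,
    add_sub_cancel_left]
  nlinarith [Real.add_one_le_exp ((A *ᵥ x') j - (A *ᵥ x) j), Real.exp_pos ((A *ᵥ x) j)]

variable [DecidableEq κ]

omit [Fintype ι] in
lemma mulVec_update_apply (A : Matrix ι κ ℝ) (x : κ → ℝ) (k : κ) (u : ℝ) (j : ι) :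
    (A *ᵥ Function.update x k u) j = (A *ᵥ x) j + A j k * (u - x k) := by
  have h : Function.update x k u = x + Pi.single k (u - x k) := by
    ext l
    rcases eq_or_ne l k with rfl | hl <;> simp [*]
  simp [h, mulVec_add]

lemma hasDerivAt_expSum_update (A : Matrix ι κ ℝ) (x : κ → ℝ) (k : κ) :
    HasDerivAt (fun u => expSum A (Function.update x k u)) (expSumGrad A x k) (x k) := by
  simp only [expSum, mulVec_update_apply]
  refine HasDerivAt.fun_sum fun j _ => ?_
  simpa using ((((hasDerivAt_id (x k)).sub_const (x k)).const_mul (A j k)).const_add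
    ((A *ᵥ x) j)).exp

lemma exp_mul_sub_one_le {u δ : ℝ} (hδ : |δ| ≤ 1) (hε : ε ≤ 1) (hu : u ∈ Set.Icc 0 ε) :
    Real.exp (δ * u) - 1 ≤ (δ + ε) * u := by
  have hδu : |δ * u| ≤ u := by
    rw [abs_mul, abs_of_nonneg hu.1]
    exact mul_le_of_le_one_left hu.1 hδ
  have hsq : (δ * u) ^ 2 ≤ ε * u := by
    rw [← sq_abs]
    nlinarith [hu.1, hu.2, abs_nonneg (δ * u)]
  have hexp := (abs_le.1 (Real.abs_exp_sub_one_sub_id_le (hδu.trans (hu.2.trans hε)))).2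
  linarith

lemma expSum_add_single_sub_le {δ : ℝ} (hδ : |δ| ≤ 1) (hε : ε ≤ 1)
    (hA : ∀ j k, A j k ∈ Set.Icc 0 ε) (x : κ → ℝ) (k : κ) :
    expSum A (x + Pi.single k δ) - expSum A x ≤ (δ + ε) * expSumGrad A x k := by
  simp only [expSum, expSumGrad, vecMul, dotProduct]
  rw [← Finset.sum_sub_distrib, Finset.mul_sum]
  refine Finset.sum_le_sum fun j _ => ?_
  have hstep : (A *ᵥ (x + Pi.single k δ)) j = (A *ᵥ x) j + δ * A j k := by simp [mulVec_add]
  rw [hstep, Real.exp_add]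
  nlinarith [exp_mul_sub_one_le hδ hε (hA j k), Real.exp_pos ((A *ᵥ x) j)]

end ExpSum

section MeasureTheory

variable {α : Type*} [MeasurableSpace α] {μ : Measure α}

lemma integrable_and_integral_le_of_tendsto {f : ℕ → α → ℝ} {g : α → ℝ} {R : ℝ}
    (hf : ∀ n, Integrable (f n) μ) (hf₀ : ∀ n x, 0 ≤ f n x)
    (hlim : ∀ x, Tendsto (fun n => f n x) atTop (𝓝 (g x))) (hR : ∀ n, ∫ x, f n x ∂μ ≤ R) :
    Integrable g μ ∧ ∫ x, g x ∂μ ≤ R := by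
  have hg₀ : 0 ≤ᵐ[μ] g := .of_forall fun x => ge_of_tendsto' (hlim x) fun n => hf₀ n x
  have hg : AEStronglyMeasurable g μ :=
    aestronglyMeasurable_of_tendsto_ae atTop (fun n => (hf n).1) (.of_forall hlim)
  have hfatou : ∫⁻ x, ENNReal.ofReal (g x) ∂μ ≤ ENNReal.ofReal R :=
    calc ∫⁻ x, ENNReal.ofReal (g x) ∂μ
        = ∫⁻ x, liminf (fun n => ENNReal.ofReal (f n x)) atTop ∂μ :=
          lintegral_congr fun x => (ENNReal.tendsto_ofReal (hlim x)).liminf_eq.symm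
      _ ≤ liminf (fun n => ∫⁻ x, ENNReal.ofReal (f n x) ∂μ) atTop :=
          lintegral_liminf_le' fun n => (hf n).1.aemeasurable.ennreal_ofReal
      _ ≤ ENNReal.ofReal R := liminf_le_of_frequently_le' <| .of_forall fun n => by
          rw [← ofReal_integral_eq_lintegral_ofReal (hf n) (.of_forall (hf₀ n))]
          exact ENNReal.ofReal_le_ofReal (hR n)
  have hR₀ : 0 ≤ R := (integral_nonneg (hf₀ 0)).trans (hR 0)
  refine ⟨⟨hg, (hasFiniteIntegral_iff_ofReal hg₀).2 (hfatou.trans_lt ENNReal.ofReal_lt_top)⟩, ?_⟩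
  rw [integral_eq_lintegral_of_nonneg_ae hg₀ hg]
  exact ENNReal.toReal_le_of_le_ofReal hR₀ hfatou

lemma tendsto_ceil_mul_div_nhdsGE (t : ℝ≥0) :
    Tendsto (fun n : ℕ => (⌈t * (n + 1)⌉₊ : ℝ≥0) / (n + 1)) atTop (𝓝[≥] t) := by
  refine tendsto_nhdsWithin_iff.2 ⟨?_, .of_forall fun n => ?_⟩
  · rw [← NNReal.tendsto_coe]
    refine ((tendsto_nat_ceil_mul_div_atTop t.coe_nonneg).comp
      (tendsto_natCast_atTop_atTop.comp (tendsto_add_atTop_nat 1))).congr fun n => ?_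
    have hceil : ⌈((t * (n + 1) : ℝ≥0) : ℝ)⌉₊ = ⌈t * (n + 1)⌉₊ := Nonneg.nat_ceil_coe _
    simp [← hceil]
  · exact (le_div_iff₀ (by positivity : (0 : ℝ≥0) < n + 1)).2 (Nat.le_ceil _)

lemma measurable_uncurry_of_continuousWithinAt_Ici {β : Type*} [TopologicalSpace β]
    [TopologicalSpace.PseudoMetrizableSpace β] [MeasurableSpace β] [BorelSpace β]
    {u : ℝ≥0 → α → β} (hu : ∀ t, Measurable (u t))
    (hcont : ∀ x t, ContinuousWithinAt (fun r => u r x) (Set.Ici t) t) :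
    Measurable (Function.uncurry u) := by
  have hgrid (n : ℕ) :
      Measurable fun q : ℝ≥0 × α => u ((⌈q.1 * (n + 1)⌉₊ : ℝ≥0) / (n + 1)) q.2 := by
    have hcell : Measurable fun r : ℕ × α => u ((r.1 : ℝ≥0) / (n + 1)) r.2 :=
      measurable_from_prod_countable_right fun k => hu (k / (n + 1))
    have hindex : Measurable fun q : ℝ≥0 × α => ⌈q.1 * (n + 1)⌉₊ :=
      Nat.measurable_ceil.comp (measurable_fst.mul_const _)
    exact hcell.comp (hindex.prodMk measurable_snd)
  refine measurable_of_tendsto_metrizable hgrid (tendsto_pi_nhds.2 fun q => ?_)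
  exact Tendsto.comp (hcont q.2 q.1) (tendsto_ceil_mul_div_nhdsGE q.1)

open Matrix in
lemma expSum_integral_le {ι κ : Type*} [Fintype ι] [Fintype κ] [IsProbabilityMeasure μ]
    (A : Matrix ι κ ℝ) {Y : α → κ → ℝ} (hY : ∀ k, Integrable (fun ω => Y ω k) μ)
    (hexp : Integrable (fun ω => expSum A (Y ω)) μ) :
    expSum A (fun k => ∫ ω, Y ω k ∂μ) ≤ ∫ ω, expSum A (Y ω) ∂μ := by
  set x : κ → ℝ := fun k => ∫ ω, Y ω k ∂μ
  have hcoord (k) : Integrable (fun ω => expSumGrad A x k * (Y ω k - x k)) μ :=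
    ((hY k).sub (integrable_const _)).const_mul _
  have hmean : ∫ ω, expSumGrad A x ⬝ᵥ (Y ω - x) ∂μ = 0 := by
    simp only [dotProduct, Pi.sub_apply]
    rw [integral_finsetSum _ fun k _ => hcoord k]
    refine Finset.sum_eq_zero fun k _ => ?_
    rw [integral_const_mul, integral_sub (hY k) (integrable_const _), integral_const, probReal_univ,
      one_smul, sub_self, mul_zero]
  have htangent : ∫ ω, expSumGrad A x ⬝ᵥ (Y ω - x) ∂μ ≤ ∫ ω, (expSum A (Y ω) - expSum A x) ∂μ :=
    integral_mono (integrable_finsetSum _ fun k _ => hcoord k) (hexp.sub (integrable_const _))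
      fun ω => expSumGrad_dotProduct_sub_le A x (Y ω)
  rw [hmean, integral_sub hexp (integrable_const _), integral_const, probReal_univ,
    one_smul] at htangent
  exact sub_nonneg.1 htangent

end MeasureTheory

variable {m s : ℕ}

section States

variable (M : Model m s) (β : ℝ) (i : Fin m) (z : State m)

/-- The state as a real vector `(x, y)`: the coordinates `Sum.inl i` and `Sum.inr i` are the numbers
of class `i` requests in the original and in the fictitious system. -/
def stateVec : Fin m ⊕ Fin m → ℝ := Sum.elim (fun i => z.1 i) (fun i => z.2 i)

/-- The total number of requests in both systems. -/
def size : ℕ := ∑ i, z.1 i + ∑ i, z.2 i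

/-- The state after a departure from the class and system given by a coordinate of `stateVec`. -/
def depart : Fin m ⊕ Fin m → State m → State m := Sum.elim departX departY

/-- The service rate belonging to a coordinate of `stateVec`. -/
def Model.rate : Fin m ⊕ Fin m → ℝ := Sum.elim M.mu M.mu

open Classical in
/-- The coordinate of `stateVec` which a class `i` arrival increases. -/
noncomputable def Model.route : Fin m ⊕ Fin m :=
  if M.Accepts β i z then .inl i else .inr i

variable {z} in
lemma stateVec_nonneg (k : Fin m ⊕ Fin m) : 0 ≤ stateVec z k := by
  rcases k with i | i <;> exact Nat.cast_nonneg _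

lemma sum_stateVec : ∑ k, stateVec z k = size z := by
  simp [stateVec, size]

lemma finite_setOf_size_lt (N : ℕ) : {z : State m | size z < N}.Finite := by
  refine ((Set.finite_Iic fun _ => N).prod (Set.finite_Iic fun _ => N)).subset fun z hz => ?_
  have hz' : ∑ i, z.1 i + ∑ i, z.2 i < N := hz
  refine ⟨fun i => ?_, fun i => ?_⟩
  · have := Finset.single_le_sum (fun i _ => Nat.zero_le (z.1 i)) (Finset.mem_univ i)
    lia
  · have := Finset.single_le_sum (fun i _ => Nat.zero_le (z.2 i)) (Finset.mem_univ i)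
    lia

lemma stateVec_arrive :
    stateVec (M.arrive β i z) = stateVec z + Pi.single (M.route β i z) 1 := by
  by_cases h : M.Accepts β i z <;> ext (l | l) <;> rcases eq_or_ne l i with rfl | hl <;>
    simp [stateVec, Model.arrive, Model.route, *]

lemma size_arrive : size (M.arrive β i z) = size z + 1 := by
  have h : (size (M.arrive β i z) : ℝ) = size z + 1 := by
    simp [← sum_stateVec, stateVec_arrive, Finset.sum_add_distrib]
  exact_mod_cast h

variable {z} {k : Fin m ⊕ Fin m}

lemma depart_eq_self (hk : stateVec z k = 0) : depart k z = z := by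
  rcases k with i | i
  · have hi : z.1 i - 1 = z.1 i := by rw [Nat.cast_eq_zero.1 hk]
    simp [depart, departX, hi]
  · have hi : z.2 i - 1 = z.2 i := by rw [Nat.cast_eq_zero.1 hk]
    simp [depart, departY, hi]

lemma stateVec_depart (hk : stateVec z k ≠ 0) :
    stateVec (depart k z) = stateVec z + Pi.single k (-1) := by
  rcases k with i | i
  all_goals
    simp only [stateVec, Sum.elim_inl, Sum.elim_inr, ne_eq, Nat.cast_eq_zero] at hk
    ext (l | l) <;> rcases eq_or_ne l i with rfl | hl <;>
      simp [stateVec, depart, departX, departY, Nat.cast_pred (Nat.pos_of_ne_zero hk),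
        sub_eq_add_neg, *]

variable (z k) in
lemma size_depart : size (depart k z) = size z ∨ size (depart k z) + 1 = size z := by
  by_cases hk : stateVec z k = 0
  · exact .inl (congrArg size (depart_eq_self hk))
  · have h : (size (depart k z) : ℝ) + 1 = size z := by
      simp [← sum_stateVec, stateVec_depart hk, Finset.sum_add_distrib]
    exact .inr (mod_cast h)

end States

section Penalty

open Matrix

variable (M : Model m s) (β : ℝ)

lemma Model.Dpos_sub_Dneg (j : Fin s) (i : Fin m) : M.Dpos j i - M.Dneg j i = M.D j i :=
  max_zero_sub_max_neg_zero_eq_self _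

/-- The matrix of the linear forms `β (d_j⁺ x + d_j⁻ y) / H_j` of the pair `(x, y)`. -/
noncomputable def Model.penaltyMatrix : Matrix (Fin s) (Fin m ⊕ Fin m) ℝ :=
  of fun j => Sum.elim (fun i => β * M.Dpos j i / M.cap j) (fun i => β * M.Dneg j i / M.cap j)

variable {M β} in
lemma Model.penaltyMatrix_mem_Icc {ε : ℝ} (hcap : ∀ j, 0 < M.cap j) (hβ₀ : 0 ≤ β)
    (hβ : ∀ j i, β * |M.D j i| ≤ ε * M.cap j) (j : Fin s) (k : Fin m ⊕ Fin m) :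
    M.penaltyMatrix β j k ∈ Set.Icc 0 ε := by
  rcases k with i | i
  all_goals
    refine ⟨div_nonneg (mul_nonneg hβ₀ (le_max_right _ _)) (hcap j).le,
      (div_le_iff₀ (hcap j)).2 (le_trans ?_ (hβ j i))⟩
    simp only [Dpos, Dneg]
    gcongr
    grind

lemma Model.penaltyMatrix_mulVec (x y : Fin m → ℝ) (j : Fin s) :
    (M.penaltyMatrix β *ᵥ Sum.elim x y) j = β * M.ratio j x y := by
  simp only [penaltyMatrix, ratio, mulVec, dotProduct, of_apply, Fintype.sum_sum_type,
    Sum.elim_inl, Sum.elim_inr, mul_add, add_div, Finset.sum_div, Finset.mul_sum]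
  congr! 2 <;> ring

lemma Model.penalty_eq (x y : Fin m → ℝ) :
    M.penalty β x y = expSum (M.penaltyMatrix β) (Sum.elim x y) := by
  simp only [penalty, expSum, penaltyMatrix_mulVec]

lemma Model.partialX_eq (i : Fin m) (x y : Fin m → ℝ) :
    M.partialX β i x y = expSumGrad (M.penaltyMatrix β) (Sum.elim x y) (.inl i) := by
  simp only [partialX, penalty_eq, Sum.elim_update_left]
  exact (hasDerivAt_expSum_update _ (Sum.elim x y) (.inl i)).deriv

lemma Model.partialY_eq (i : Fin m) (x y : Fin m → ℝ) :
    M.partialY β i x y = expSumGrad (M.penaltyMatrix β) (Sum.elim x y) (.inr i) := by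
  simp only [partialY, penalty_eq, Sum.elim_update_right]
  exact (hasDerivAt_expSum_update _ (Sum.elim x y) (.inr i)).deriv

lemma Model.expSumGrad_route (i : Fin m) (z : State m) :
    expSumGrad (M.penaltyMatrix β) (stateVec z) (M.route β i z) =
      min (expSumGrad (M.penaltyMatrix β) (stateVec z) (.inl i))
        (expSumGrad (M.penaltyMatrix β) (stateVec z) (.inr i)) := by
  simp only [route, Accepts, partialX_eq, partialY_eq, min_def]
  exact apply_ite _ _ _ _

end Penalty

section Drift

open Matrix

variable {M : Model m s} {β ε : ℝ}

lemma Model.muMin_le (i : Fin m) : M.muMin ≤ M.mu i :=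
  ciInf_le (Set.finite_range _).bddBelow i

lemma Model.le_muMax (i : Fin m) : M.mu i ≤ M.muMax :=
  le_ciSup (Set.finite_range _).bddAbove i

lemma Model.muMin_pos [NeZero m] (hmu : ∀ i, 0 < M.mu i) : 0 < M.muMin := by
  obtain ⟨i, hi⟩ := exists_eq_ciInf_of_finite (f := M.mu)
  exact (hmu i).trans_eq hi

lemma Model.muMax_pos [NeZero m] (hmu : ∀ i, 0 < M.mu i) : 0 < M.muMax :=
  (hmu 0).trans_le (le_muMax 0)

lemma Model.muMin_le_rate (k : Fin m ⊕ Fin m) : M.muMin ≤ M.rate k := by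
  rcases k with i | i <;> exact muMin_le i

lemma Model.rate_nonneg (hmu : ∀ i, 0 ≤ M.mu i) (k : Fin m ⊕ Fin m) : 0 ≤ M.rate k := by
  rcases k with i | i <;> exact hmu i

lemma Model.generator_eq (M : Model m s) (β : ℝ) (f : State m → ℝ) (z : State m) :
    M.generator β f z = ∑ i, M.lam i * (f (M.arrive β i z) - f z)
      + ∑ k, M.rate k * stateVec z k * (f (depart k z) - f z) := by
  simp only [generator, Fintype.sum_sum_type, Finset.sum_add_distrib, add_assoc, rate, stateVec,
    depart, Sum.elim_inl, Sum.elim_inr]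

/-- The penalty function `Ψ` as a function of the state. -/
noncomputable def Model.statePenalty (M : Model m s) (β : ℝ) (z : State m) : ℝ :=
  expSum (M.penaltyMatrix β) (stateVec z)

lemma Model.generator_statePenalty_le (hlam : ∀ i, 0 ≤ M.lam i) (hmu : ∀ i, 0 ≤ M.mu i)
    (hε : ε ≤ 1) (hW : ∀ j k, M.penaltyMatrix β j k ∈ Set.Icc 0 ε) (z : State m) :
    M.generator β (M.statePenalty β) z ≤
      (1 + ε) * ∑ i, M.lam i * min (expSumGrad (M.penaltyMatrix β) (stateVec z) (.inl i))
          (expSumGrad (M.penaltyMatrix β) (stateVec z) (.inr i))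
        - (1 - ε) * ∑ k, M.rate k * (stateVec z k *
          expSumGrad (M.penaltyMatrix β) (stateVec z) k) := by
  rw [generator_eq, Finset.mul_sum, Finset.mul_sum, sub_eq_add_neg, ← Finset.sum_neg_distrib]
  refine add_le_add (Finset.sum_le_sum fun i _ => ?_) (Finset.sum_le_sum fun k _ => ?_)
  · have hstep := expSum_add_single_sub_le (δ := 1) (by simp) hε hW (stateVec z) (M.route β i z)
    rw [← stateVec_arrive, expSumGrad_route] at hstep
    exact (mul_le_mul_of_nonneg_left hstep (hlam i)).trans_eq (by ring)
  · rcases eq_or_ne (stateVec z k) 0 with hk | hk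
    · simp [hk]
    · have hstep := expSum_add_single_sub_le (δ := -1) (by simp) hε hW (stateVec z) k
      rw [← stateVec_depart hk] at hstep
      exact (mul_le_mul_of_nonneg_left hstep
        (mul_nonneg (rate_nonneg hmu k) (stateVec_nonneg k))).trans_eq (by ring)

variable {p : (Fin m → ℝ) × (Fin m → ℝ)}

lemma Model.sum_lam_mul_min_le (hmu : ∀ i, 0 < M.mu i) (hp₁ : 0 ≤ p.1) (hp₂ : 0 ≤ p.2)
    (hload : ∀ i, M.load i ≤ p.1 i + p.2 i) {g : Fin m ⊕ Fin m → ℝ} (hg : ∀ k, 0 ≤ g k) :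
    ∑ i, M.lam i * min (g (.inl i)) (g (.inr i)) ≤ M.muMax * (g ⬝ᵥ Sum.elim p.1 p.2) := by
  simp only [dotProduct, Fintype.sum_sum_type, Sum.elim_inl, Sum.elim_inr,
    ← Finset.sum_add_distrib, Finset.mul_sum]
  refine Finset.sum_le_sum fun i _ => ?_
  have hg_min : 0 ≤ min (g (.inl i)) (g (.inr i)) := le_min (hg _) (hg _)
  have hlam_le : M.lam i ≤ M.mu i * (p.1 i + p.2 i) := by
    rw [mul_comm]
    exact (div_le_iff₀ (hmu i)).1 (hload i)
  calc M.lam i * min (g (.inl i)) (g (.inr i))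
      ≤ M.mu i * (p.1 i + p.2 i) * min (g (.inl i)) (g (.inr i)) := by gcongr
    _ = M.mu i * (min (g (.inl i)) (g (.inr i)) * p.1 i
          + min (g (.inl i)) (g (.inr i)) * p.2 i) := by ring
    _ ≤ M.muMax * (g (.inl i) * p.1 i + g (.inr i) * p.2 i) := by
        refine mul_le_mul (le_muMax i) (add_le_add ?_ ?_)
          (add_nonneg (mul_nonneg hg_min (hp₁ i)) (mul_nonneg hg_min (hp₂ i)))
          ((hmu i).le.trans (le_muMax i))
        · exact mul_le_mul_of_nonneg_right (min_le_left _ _) (hp₁ i)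
        · exact mul_le_mul_of_nonneg_right (min_le_right _ _) (hp₂ i)

lemma Model.penaltyLevel_eq (M : Model m s) (β ε : ℝ) (p : (Fin m → ℝ) × (Fin m → ℝ)) :
    M.penaltyLevel β ε p = expSum (M.penaltyMatrix β)
      (((1 + 3 * ε) * M.muMax / M.muMin) • Sum.elim p.1 p.2) := by
  rw [penaltyLevel, penalty_eq]
  congr 1
  ext (i | i) <;> rfl

lemma Model.generator_statePenalty_le_mul_penaltyLevel_sub [NeZero m] (hlam : ∀ i, 0 ≤ M.lam i)
    (hmu : ∀ i, 0 < M.mu i) (hε₀ : 0 ≤ ε) (hε : ε ≤ 1 / 3)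
    (hW : ∀ j k, M.penaltyMatrix β j k ∈ Set.Icc 0 ε) (hp₁ : 0 ≤ p.1) (hp₂ : 0 ≤ p.2)
    (hload : ∀ i, M.load i ≤ p.1 i + p.2 i) (z : State m) :
    M.generator β (M.statePenalty β) z ≤
      (1 - ε) * M.muMin * (M.penaltyLevel β ε p - M.statePenalty β z) := by
  set g := expSumGrad (M.penaltyMatrix β) (stateVec z)
  have hg (k) : 0 ≤ g k := expSumGrad_nonneg (fun j k => (hW j k).1) _ k
  have hmin : 0 < M.muMin := muMin_pos hmu
  have hε₁ : 0 ≤ 1 - ε := by linarith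
  have harrivals : (1 + ε) * ∑ i, M.lam i * min (g (.inl i)) (g (.inr i)) ≤
      (1 - ε) * ((1 + 3 * ε) * M.muMax * (g ⬝ᵥ Sum.elim p.1 p.2)) := by
    have hsum := sum_lam_mul_min_le hmu hp₁ hp₂ hload hg
    have hmin_nonneg : 0 ≤ ∑ i, M.lam i * min (g (.inl i)) (g (.inr i)) :=
      Finset.sum_nonneg fun i _ => mul_nonneg (hlam i) (le_min (hg _) (hg _))
    nlinarith [mul_nonneg hε₀ (sub_nonneg.2 hε)]
  have hdepartures : M.muMin * (g ⬝ᵥ stateVec z) ≤ ∑ k, M.rate k * (stateVec z k * g k) := by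
    rw [dotProduct_comm, dotProduct, Finset.mul_sum]
    gcongr with k
    exacts [mul_nonneg (stateVec_nonneg k) (hg k), muMin_le_rate k]
  have hgradient := expSumGrad_dotProduct_sub_le (M.penaltyMatrix β) (stateVec z)
    (((1 + 3 * ε) * M.muMax / M.muMin) • Sum.elim p.1 p.2)
  rw [← penaltyLevel_eq, dotProduct_sub, dotProduct_smul, smul_eq_mul] at hgradient
  calc M.generator β (M.statePenalty β) z
      ≤ (1 - ε) * ((1 + 3 * ε) * M.muMax * (g ⬝ᵥ Sum.elim p.1 p.2))
          - (1 - ε) * (M.muMin * (g ⬝ᵥ stateVec z)) :=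
        (generator_statePenalty_le hlam (fun i => (hmu i).le) (by linarith) hW z).trans
          (sub_le_sub harrivals (mul_le_mul_of_nonneg_left hdepartures hε₁))
    _ = (1 - ε) * M.muMin * ((1 + 3 * ε) * M.muMax / M.muMin * (g ⬝ᵥ Sum.elim p.1 p.2)
          - g ⬝ᵥ stateVec z) := by field_simp
    _ ≤ (1 - ε) * M.muMin * (M.penaltyLevel β ε p - M.statePenalty β z) := by
        exact mul_le_mul_of_nonneg_left hgradient (mul_nonneg hε₁ hmin.le)

lemma Model.penaltyLevel_le [NeZero m] (hmu : ∀ i, 0 < M.mu i) (hε₀ : 0 ≤ ε) (hβ₀ : 0 ≤ β)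
    (hrates : M.violation p ≤ M.muMin / M.muMax) :
    M.penaltyLevel β ε p ≤ s * Real.exp (β * (1 + 3 * ε)) := by
  have hmin : 0 < M.muMin := muMin_pos hmu
  have hmax : 0 < M.muMax := muMax_pos hmu
  rw [penaltyLevel_eq]
  refine (expSum_le_card_mul_exp fun j => ?_).trans_eq (by rw [Fintype.card_fin])
  have hratio : M.ratio j p.1 p.2 ≤ M.muMin / M.muMax :=
    (le_ciSup (f := fun j => M.ratio j p.1 p.2) (Set.finite_range _).bddAbove j).trans hrates
  calc (M.penaltyMatrix β *ᵥ (((1 + 3 * ε) * M.muMax / M.muMin) • Sum.elim p.1 p.2)) j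
      = (1 + 3 * ε) * M.muMax / M.muMin * (β * M.ratio j p.1 p.2) := by
        rw [mulVec_smul, Pi.smul_apply, penaltyMatrix_mulVec, smul_eq_mul]
    _ ≤ (1 + 3 * ε) * M.muMax / M.muMin * (β * (M.muMin / M.muMax)) := by gcongr
    _ = β * (1 + 3 * ε) := by field_simp

end Drift

section Generator

variable {M : Model m s} {β ε b : ℝ} {f g : State m → ℝ} {z : State m}

lemma Model.generator_congr
    (hfg : ∀ w, size w ≤ size z + 1 → size z ≤ size w + 1 → f w = g w) :
    M.generator β f z = M.generator β g z := by
  have hz : f z = g z := hfg z (by lia) (by lia)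
  have harrive (i) : f (M.arrive β i z) = g (M.arrive β i z) := by
    have := size_arrive M β i z
    exact hfg _ (by lia) (by lia)
  have hdepart (k) : f (depart k z) = g (depart k z) := by
    have := size_depart z k
    exact hfg _ (by lia) (by lia)
  simp only [generator_eq, hz, harrive, hdepart]

lemma Model.generator_neg (M : Model m s) (β : ℝ) (f : State m → ℝ) (z : State m) :
    M.generator β (fun w => -f w) z = -M.generator β f z := by
  simp only [generator_eq, neg_add, ← Finset.sum_neg_distrib]
  congr! 2 <;> ring

lemma Model.generator_sub_const (M : Model m s) (β : ℝ) (f : State m → ℝ) (a : ℝ) :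
    M.generator β (fun w => f w - a) = M.generator β f := by
  ext z
  simp only [generator_eq, sub_sub_sub_cancel_right]

lemma Model.finite_support_generator (hf : (Function.support f).Finite) :
    (Function.support (M.generator β f)).Finite := by
  obtain ⟨N, hN⟩ := (hf.image size).bddAbove
  refine (finite_setOf_size_lt (N + 2)).subset fun z hz => ?_
  by_contra hzN
  have hzN : N + 2 ≤ size z := not_lt.1 hzN
  refine hz ((generator_congr (g := 0) fun w _ hw => ?_).trans (by simp [generator]))
  by_contra hfw
  have := hN (Set.mem_image_of_mem size hfw)
  lia

/-- The number of class `i` requests in both systems together. -/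
def classCount (i : Fin m) (z : State m) : ℝ := stateVec z (.inl i) + stateVec z (.inr i)

/-- Whatever the routing, class `i` requests as a whole form an infinite-server queue. -/
lemma Model.generator_classCount (M : Model m s) (β : ℝ) (i : Fin m) (z : State m) :
    M.generator β (classCount i) z = M.lam i - M.mu i * classCount i z := by
  have harrive (l) : classCount i (M.arrive β l z) - classCount i z = if i = l then 1 else 0 := by
    rcases eq_or_ne i l with rfl | hl <;> by_cases hacc : M.Accepts β i z <;>
      simp [classCount, stateVec_arrive, route, Pi.single_apply, *] <;> grind
  have hdepart (k) : M.rate k * stateVec z k * (classCount i (depart k z) - classCount i z) =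
      -(M.rate k * stateVec z k *
        ((Pi.single k 1 : _ → ℝ) (.inl i) + (Pi.single k 1 : _ → ℝ) (.inr i))) := by
    by_cases hk : stateVec z k = 0
    · simp [hk]
    · simp only [classCount, stateVec_depart hk, Pi.single_neg, Pi.add_apply, Pi.neg_apply]
      ring
  simp only [generator_eq, harrive, hdepart]
  simp only [Pi.single_apply, mul_ite, mul_one, mul_zero, Finset.sum_ite_eq, Finset.mem_univ,
    if_true, rate, mul_add, Finset.sum_neg_distrib, Finset.sum_add_distrib, Sum.elim_inr,
    Sum.elim_inl, classCount]
  ring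

lemma Model.generator_pow_min_size_le (hlam : ∀ i, 0 ≤ M.lam i) (hmu : ∀ i, 0 ≤ M.mu i)
    (hb : 1 ≤ b) (N : ℕ) (z : State m) :
    M.generator β (fun w => b ^ min (size w) N) z ≤
      (∑ i, M.lam i) * (b - 1) * b ^ min (size z) N := by
  have harrive (i) : b ^ min (size (M.arrive β i z)) N - b ^ min (size z) N ≤
      (b - 1) * b ^ min (size z) N := by
    have := size_arrive M β i z
    have := pow_le_pow_right₀ hb
      (by lia : min (size (M.arrive β i z)) N ≤ min (size z) N + 1)
    rw [pow_succ] at this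
    linarith
  have hdepart (k) : b ^ min (size (depart k z)) N - b ^ min (size z) N ≤ 0 := by
    have := size_depart z k
    exact sub_nonpos.2 (pow_le_pow_right₀ hb (by lia))
  rw [generator_eq, mul_assoc, Finset.sum_mul]
  refine add_le_of_le_of_nonpos
    (Finset.sum_le_sum fun i _ => mul_le_mul_of_nonneg_left (harrive i) (hlam i))
    (Finset.sum_nonpos fun k _ => mul_nonpos_of_nonneg_of_nonpos ?_ (hdepart k))
  exact mul_nonneg (rate_nonneg hmu k) (stateVec_nonneg k)

lemma stateVec_le_size (z : State m) (k : Fin m ⊕ Fin m) : stateVec z k ≤ size z := by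
  rw [← sum_stateVec]
  exact Finset.single_le_sum (fun k _ => stateVec_nonneg k) (Finset.mem_univ k)

lemma abs_stateVec_mul_depart_sub_le {C : ℝ} (hb : 1 ≤ b) (hf : ∀ w, |f w| ≤ C * b ^ size w)
    (z : State m) (k : Fin m ⊕ Fin m) :
    |stateVec z k * (f (depart k z) - f z)| ≤ 2 * C * (2 * b) ^ size z := by
  have hb₀ : 0 < b := one_pos.trans_le hb
  have hC : 0 ≤ C :=
    nonneg_of_mul_nonneg_left ((abs_nonneg _).trans (hf z)) (pow_pos hb₀ (size z))
  have hle : size (depart k z) ≤ size z := by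
    have := size_depart z k
    lia
  have hsize : (size z : ℝ) * b ^ size z ≤ (2 * b) ^ size z := by
    rw [mul_pow]
    gcongr
    exact_mod_cast Nat.lt_two_pow_self.le
  calc |stateVec z k * (f (depart k z) - f z)|
      ≤ size z * (C * b ^ size z + C * b ^ size z) := by
        rw [abs_mul, abs_of_nonneg (stateVec_nonneg k)]
        gcongr
        · exact stateVec_le_size z k
        · exact (abs_sub _ _).trans (add_le_add ((hf _).trans (by gcongr)) (hf _))
    _ = 2 * C * (size z * b ^ size z) := by ring
    _ ≤ 2 * C * (2 * b) ^ size z := by gcongr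

lemma Model.abs_generator_le {C : ℝ} (hb : 1 ≤ b) (hf : ∀ w, |f w| ≤ C * b ^ size w)
    (z : State m) :
    |M.generator β f z| ≤
      ((∑ i, |M.lam i|) * (C * b + C) + (∑ k, |M.rate k|) * (2 * C)) * (2 * b) ^ size z := by
  have hb₀ : 0 < b := one_pos.trans_le hb
  have hC : 0 ≤ C :=
    nonneg_of_mul_nonneg_left ((abs_nonneg _).trans (hf z)) (pow_pos hb₀ (size z))
  have harrive (i) : |f (M.arrive β i z) - f z| ≤ (C * b + C) * (2 * b) ^ size z :=
    calc |f (M.arrive β i z) - f z| ≤ C * b ^ (size z + 1) + C * b ^ size z := by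
          rw [← size_arrive M β i z]
          exact (abs_sub _ _).trans (add_le_add (hf _) (hf _))
      _ = (C * b + C) * b ^ size z := by ring
      _ ≤ (C * b + C) * (2 * b) ^ size z := by gcongr; linarith
  rw [generator_eq, add_mul, mul_assoc, mul_assoc, Finset.sum_mul, Finset.sum_mul]
  refine (abs_add_le _ _).trans (add_le_add ?_ ?_)
  · refine (Finset.abs_sum_le_sum_abs _ _).trans (Finset.sum_le_sum fun i _ => ?_)
    rw [abs_mul]
    exact mul_le_mul_of_nonneg_left (harrive i) (abs_nonneg _)
  · refine (Finset.abs_sum_le_sum_abs _ _).trans (Finset.sum_le_sum fun k _ => ?_)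
    rw [mul_assoc, abs_mul]
    exact mul_le_mul_of_nonneg_left (abs_stateVec_mul_depart_sub_le hb hf z k) (abs_nonneg _)

/-- Test functions which grow at most exponentially in the number of requests. -/
def ExpGrowth (f : State m → ℝ) : Prop := ∃ C b : ℝ, 1 ≤ b ∧ ∀ z, |f z| ≤ C * b ^ size z

lemma ExpGrowth.generator (hf : ExpGrowth f) : ExpGrowth (M.generator β f) := by
  obtain ⟨C, b, hb, hfC⟩ := hf
  exact ⟨_, 2 * b, by linarith, M.abs_generator_le hb hfC⟩

lemma ExpGrowth.neg (hf : ExpGrowth f) : ExpGrowth (fun z => -f z) := by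
  simpa only [ExpGrowth, abs_neg] using hf

lemma abs_stateVec_le_two_pow_size (z : State m) (k : Fin m ⊕ Fin m) :
    |stateVec z k| ≤ 2 ^ size z := by
  rw [abs_of_nonneg (stateVec_nonneg k)]
  exact (stateVec_le_size z k).trans (mod_cast Nat.lt_two_pow_self.le)

lemma expGrowth_stateVec (k : Fin m ⊕ Fin m) : ExpGrowth fun z => stateVec z k :=
  ⟨1, 2, one_le_two, fun z => (abs_stateVec_le_two_pow_size z k).trans_eq (one_mul _).symm⟩

lemma expGrowth_classCount (i : Fin m) : ExpGrowth (classCount i) :=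
  ⟨2, 2, one_le_two, fun z => (abs_add_le _ _).trans <| (add_le_add
    (abs_stateVec_le_two_pow_size z _) (abs_stateVec_le_two_pow_size z _)).trans_eq
      (two_mul _).symm⟩

lemma Model.expGrowth_statePenalty (hε : ε ≤ 1)
    (hW : ∀ j k, M.penaltyMatrix β j k ∈ Set.Icc 0 ε) : ExpGrowth (M.statePenalty β) := by
  refine ⟨Fintype.card (Fin s), Real.exp 1, Real.one_le_exp zero_le_one, fun z => ?_⟩
  rw [statePenalty, abs_of_nonneg (expSum_nonneg _ _), ← Real.exp_nat_mul, mul_one]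
  refine expSum_le_card_mul_exp fun j => ?_
  rw [← sum_stateVec]
  exact Finset.sum_le_sum (s := Finset.univ) fun k _ =>
    mul_le_of_le_one_left (stateVec_nonneg k) ((hW j k).2.trans hε)

end Generator

section Dynkin

variable {S Ω : Type*} [MeasurableSpace Ω]

/-- The mean of `f` under the law of the process at time `t`. The time is real, so that it can be
integrated over; negative times are read as `0`. -/
noncomputable def meanAt (P : Measure Ω) (X : ℝ≥0 → Ω → S) (f : S → ℝ) (t : ℝ) : ℝ :=
  ∫ ω, f (X t.toNNReal ω) ∂P

/-- Dynkin's formula `E f(X_t) = f(z₀) + ∫₀ᵗ E g(X_u) du`, where `g` stands for the generator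
applied to `f`, together with the integrability it presupposes. -/
structure DynkinFormula (P : Measure Ω) (X : ℝ≥0 → Ω → S) (z₀ : S) (f g : S → ℝ) : Prop where
  integrable : ∀ t, Integrable (fun ω => f (X t ω)) P
  intervalIntegrable : ∀ t, IntervalIntegrable (meanAt P X g) volume 0 t
  meanAt_eq : ∀ t, 0 ≤ t → meanAt P X f t = f z₀ + ∫ u in 0..t, meanAt P X g u

variable {P : Measure Ω} {X : ℝ≥0 → Ω → S} {z₀ : S} {f g h : S → ℝ}

lemma meanAt_coe (P : Measure Ω) (X : ℝ≥0 → Ω → S) (f : S → ℝ) (t : ℝ≥0) :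
    meanAt P X f t = ∫ ω, f (X t ω) ∂P := by
  rw [meanAt, Real.toNNReal_coe]

lemma DynkinFormula.continuousOn_meanAt (hf : DynkinFormula P X z₀ f g) :
    ContinuousOn (meanAt P X f) (Set.Ici 0) := by
  have hprimitive : Continuous fun t => ∫ u in 0..t, meanAt P X g u :=
    intervalIntegral.continuous_primitive
      (fun a b => (hf.intervalIntegrable a).symm.trans (hf.intervalIntegrable b)) 0
  exact (continuous_const.add hprimitive).continuousOn.congr hf.meanAt_eq

lemma DynkinFormula.hasDerivWithinAt_meanAt (hf : DynkinFormula P X z₀ f g)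
    (hg : DynkinFormula P X z₀ g h) {t : ℝ} (ht : 0 ≤ t) :
    HasDerivWithinAt (meanAt P X f) (meanAt P X g t) (Set.Ici t) t := by
  have hcont : ContinuousOn (meanAt P X g) (Set.Ici t) :=
    hg.continuousOn_meanAt.mono (Set.Ici_subset_Ici.2 ht)
  have hprimitive : HasDerivWithinAt (fun r => ∫ u in 0..r, meanAt P X g u) (meanAt P X g t)
      (Set.Ici t) t :=
    intervalIntegral.integral_hasDerivWithinAt_right (hf.intervalIntegrable t)
      (t := Set.Ioi t)
      ((hcont.mono Set.Ioi_subset_Ici_self).stronglyMeasurableAtFilter_nhdsWithin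
        measurableSet_Ioi t)
      ((hcont t Set.self_mem_Ici).mono Set.Ioi_subset_Ici_self)
  exact (hprimitive.const_add (f z₀)).congr (fun r hr => hf.meanAt_eq r (ht.trans hr))
    (hf.meanAt_eq t ht)

lemma DynkinFormula.integral_le_of_le [IsProbabilityMeasure P] (hf : DynkinFormula P X z₀ f g)
    (hg : DynkinFormula P X z₀ g h) {a c : ℝ} (hdrift : ∀ z, g z ≤ c * (a - f z)) (t : ℝ≥0) :
    ∫ ω, f (X t ω) ∂P ≤ a + Real.exp (-(c * t)) * (f z₀ - a) := by
  have hbound (u : ℝ) : meanAt P X g u ≤ -c * (meanAt P X f u - a) + 0 := by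
    have hint := hf.integrable u.toNNReal
    calc meanAt P X g u ≤ ∫ ω, c * (a - f (X u.toNNReal ω)) ∂P :=
          integral_mono (hg.integrable _) (((integrable_const a).sub hint).const_mul c)
            fun ω => hdrift _
      _ = -c * (meanAt P X f u - a) + 0 := by
          rw [integral_const_mul, integral_sub (integrable_const a) hint, integral_const,
            probReal_univ, one_smul, meanAt]
          ring
  have hzero : meanAt P X f 0 = f z₀ := by simp [hf.meanAt_eq 0 le_rfl]
  have hgronwall := le_gronwallBound_of_liminf_deriv_right_le (a := 0) (b := t)
    ((hf.continuousOn_meanAt.sub continuousOn_const).mono Set.Icc_subset_Ici_self)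
    (fun u hu _ hr => ((hf.hasDerivWithinAt_meanAt hg hu.1).sub_const a).liminf_right_slope_le hr)
    le_rfl (fun u _ => hbound u) t (Set.right_mem_Icc.2 t.coe_nonneg)
  simp only [gronwallBound_ε0, sub_zero, Pi.sub_apply, hzero, meanAt_coe, neg_mul] at hgronwall
  linarith

end Dynkin

lemma exists_abs_le_of_finite_support {S : Type*} {f : S → ℝ} (hf : (Function.support f).Finite) :
    ∃ C, ∀ z, |f z| ≤ C := by
  have hrange : (Set.range f).Finite :=
    ((hf.image f).insert 0).subset (Function.range_subset_insert_image_support f)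
  obtain ⟨C, hC⟩ := (hrange.image abs).bddAbove
  exact ⟨C, fun z => hC (Set.mem_image_of_mem abs (Set.mem_range_self z))⟩

namespace IsPenaltyProcess

variable {M : Model m s} {β b C : ℝ} {y₀ : Fin m → ℕ} {Ω : Type*} [mΩ : MeasurableSpace Ω]
  {P : Measure Ω} {ℱ : Filtration ℝ≥0 mΩ} {X : ℝ≥0 → Ω → State m} {f : State m → ℝ}

lemma measurable_comp (hX : IsPenaltyProcess M β y₀ P ℱ X) (f : State m → ℝ) (t : ℝ≥0) :
    Measurable fun ω => f (X t ω) :=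
  Measurable.of_discrete.comp ((hX.adapted t).mono (ℱ.le t) le_rfl)

lemma measurable_uncurry_comp (hX : IsPenaltyProcess M β y₀ P ℱ X) (f : State m → ℝ) :
    Measurable (Function.uncurry fun (u : ℝ) ω => f (X u.toNNReal ω)) := by
  have hjoint : Measurable (Function.uncurry fun t ω => f (X t ω)) :=
    measurable_uncurry_of_continuousWithinAt_Ici (hX.measurable_comp f) fun ω t =>
      (tendsto_pure.2 ((hX.right_continuous ω t).mono fun _ hu => congrArg f hu)).mono_right
        (pure_le_nhds _)
  exact hjoint.comp ((measurable_real_toNNReal.comp measurable_fst).prodMk measurable_snd)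

variable [IsProbabilityMeasure P]

lemma measurable_meanAt (hX : IsPenaltyProcess M β y₀ P ℱ X) (f : State m → ℝ) :
    Measurable (meanAt P X f) :=
  (hX.measurable_uncurry_comp f).stronglyMeasurable.integral_prod_right'.measurable

lemma intervalIntegrable_meanAt (hX : IsPenaltyProcess M β y₀ P ℱ X) {B : ℝ → ℝ}
    (hB : Continuous B) (hfB : ∀ u, |meanAt P X f u| ≤ B u) (t : ℝ) :
    IntervalIntegrable (meanAt P X f) volume 0 t :=
  (hB.intervalIntegrable 0 t).mono_fun (hX.measurable_meanAt f).aestronglyMeasurable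
    (.of_forall fun u => (hfB u).trans (le_abs_self _))

lemma integral_zero_eq (hX : IsPenaltyProcess M β y₀ P ℱ X) (f : State m → ℝ) :
    ∫ ω, f (X 0 ω) ∂P = f (0, y₀) := by
  have hinitial : (fun ω => f (X 0 ω)) =ᵐ[P] fun _ => f (0, y₀) :=
    hX.initial.mono fun _ => congrArg f
  simp [integral_congr_ae hinitial]

lemma dynkinFormula_of_finite_support (hX : IsPenaltyProcess M β y₀ P ℱ X)
    (hf : (Function.support f).Finite) :
    DynkinFormula P X (0, y₀) f (M.generator β f) := by
  obtain ⟨C, hC⟩ := exists_abs_le_of_finite_support hf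
  obtain ⟨K, hK⟩ := exists_abs_le_of_finite_support (M.finite_support_generator (β := β) hf)
  have hint (t : ℝ≥0) : Integrable (fun ω => f (X t ω)) P :=
    .of_bound (hX.measurable_comp f t).aestronglyMeasurable C (.of_forall fun _ => hC _)
  refine ⟨hint, fun t => ?_, fun t ht => ?_⟩
  · refine hX.intervalIntegrable_meanAt (continuous_const (y := K)) (fun u => ?_) t
    have hmean := norm_integral_le_of_norm_le_const (μ := P)
      (f := fun ω => M.generator β f (X u.toNNReal ω)) (.of_forall fun ω => hK _)
    rwa [probReal_univ, mul_one] at hmean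
  · have hprod : Integrable (Function.uncurry fun (u : ℝ) ω => M.generator β f (X u.toNNReal ω))
        ((volume.restrict (Set.Ioc 0 t)).prod P) :=
      .of_bound (hX.measurable_uncurry_comp _).aestronglyMeasurable K (.of_forall fun _ => hK _)
    have hprimitive :
        Integrable (fun ω => ∫ u in Set.Ioc 0 t, M.generator β f (X u.toNNReal ω)) P :=
      hprod.integral_prod_right
    have hmart := (hX.martingale f hf).setIntegral_eq (zero_le (a := t.toNNReal)) .univ
    simp only [setIntegral_univ, Real.coe_toNNReal t ht, NNReal.coe_zero,
      intervalIntegral.integral_same, sub_zero, hX.integral_zero_eq,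
      intervalIntegral.integral_of_le ht] at hmart
    rw [integral_sub (hint _) hprimitive, ← integral_integral_swap hprod] at hmart
    rw [hmart, intervalIntegral.integral_of_le ht]
    exact (sub_add_cancel _ _).symm

lemma integrable_and_integral_pow_size_le (hX : IsPenaltyProcess M β y₀ P ℱ X)
    (hlam : ∀ i, 0 ≤ M.lam i) (hmu : ∀ i, 0 ≤ M.mu i) (hb : 1 ≤ b) (t : ℝ≥0) :
    Integrable (fun ω => b ^ size (X t ω)) P ∧ ∫ ω, b ^ size (X t ω) ∂P ≤
      Real.exp ((∑ i, M.lam i) * (b - 1) * t) * b ^ size ((0, y₀) : State m) := by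
  have : 0 < b := one_pos.trans_le hb
  have hint (N : ℕ) : Integrable (fun ω => b ^ min (size (X t ω)) N) P :=
    .of_bound (hX.measurable_comp (fun z => b ^ min (size z) N) t).aestronglyMeasurable (b ^ N)
      (.of_forall fun ω => by
        rw [Real.norm_of_nonneg (by positivity)]
        exact pow_le_pow_right₀ hb (min_le_right _ _))
  refine integrable_and_integral_le_of_tendsto hint (fun N ω => by positivity)
    (fun ω => tendsto_const_nhds.congr' ?_) fun N => ?_
  · filter_upwards [eventually_ge_atTop (size (X t ω))] with N hN
    rw [min_eq_left hN]
  have hfin : (Function.support fun z : State m => b ^ min (size z) N - b ^ N).Finite := by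
    refine (finite_setOf_size_lt N).subset fun z hz => ?_
    by_contra hN
    have hNz : N ≤ size z := not_lt.1 hN
    exact hz (by simp only [min_eq_right hNz, sub_self])
  have hdrift := (hX.dynkinFormula_of_finite_support hfin).integral_le_of_le
    (hX.dynkinFormula_of_finite_support (M.finite_support_generator hfin))
    (a := -b ^ N) (c := -((∑ i, M.lam i) * (b - 1))) (fun z => by
      rw [Model.generator_sub_const]
      exact (M.generator_pow_min_size_le hlam hmu hb N z).trans_eq (by ring)) t
  rw [integral_sub (hint N) (integrable_const _), integral_const, probReal_univ, one_smul,
    sub_neg_eq_add, sub_add_cancel, neg_mul, neg_neg] at hdrift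
  calc ∫ ω, b ^ min (size (X t ω)) N ∂P
      ≤ Real.exp ((∑ i, M.lam i) * (b - 1) * t) * b ^ min (size ((0, y₀) : State m)) N := by
        linarith
    _ ≤ Real.exp ((∑ i, M.lam i) * (b - 1) * t) * b ^ size ((0, y₀) : State m) := by
        gcongr
        exact min_le_left _ _

section ExpGrowth

variable (hX : IsPenaltyProcess M β y₀ P ℱ X) (hlam : ∀ i, 0 ≤ M.lam i) (hmu : ∀ i, 0 ≤ M.mu i)

include hX hlam hmu

lemma abs_meanAt_le (hb : 1 ≤ b) (hf : ∀ z, |f z| ≤ C * b ^ size z) (u : ℝ) :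
    |meanAt P X f u| ≤ C * (Real.exp ((∑ i, M.lam i) * (b - 1) * max u 0) *
      b ^ size ((0, y₀) : State m)) := by
  have hC : 0 ≤ C := nonneg_of_mul_nonneg_left ((abs_nonneg _).trans (hf (0, 0)))
    (pow_pos (one_pos.trans_le hb) _)
  obtain ⟨hint, hle⟩ := hX.integrable_and_integral_pow_size_le hlam hmu hb u.toNNReal
  calc |meanAt P X f u| ≤ ∫ ω, C * b ^ size (X u.toNNReal ω) ∂P := by
        rw [← Real.norm_eq_abs, meanAt]
        exact norm_integral_le_of_norm_le (hint.const_mul C) (.of_forall fun _ => hf _)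
    _ ≤ _ := by
        rw [integral_const_mul, ← Real.coe_toNNReal']
        exact mul_le_mul_of_nonneg_left hle hC

lemma tendsto_meanAt {F : ℕ → State m → ℝ} (hb : 1 ≤ b) (hF : ∀ N z, |F N z| ≤ C * b ^ size z)
    (hlim : ∀ z, ∀ᶠ N in atTop, F N z = f z) (u : ℝ) :
    Tendsto (fun N => meanAt P X (F N) u) atTop (𝓝 (meanAt P X f u)) :=
  tendsto_integral_of_dominated_convergence (fun ω => C * b ^ size (X u.toNNReal ω))
    (fun _ => (hX.measurable_comp _ _).aestronglyMeasurable)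
    ((hX.integrable_and_integral_pow_size_le hlam hmu hb _).1.const_mul C)
    (fun N => .of_forall fun _ => hF N _)
    (.of_forall fun _ => tendsto_nhds_of_eventually_eq (hlim _))

lemma integrable_comp (hf : ExpGrowth f) (t : ℝ≥0) : Integrable (fun ω => f (X t ω)) P := by
  obtain ⟨C, b, hb, hfC⟩ := hf
  exact ((hX.integrable_and_integral_pow_size_le hlam hmu hb t).1.const_mul C).mono'
    (hX.measurable_comp f t).aestronglyMeasurable (.of_forall fun ω => hfC _)

lemma dynkinFormula (hf : ExpGrowth f) : DynkinFormula P X (0, y₀) f (M.generator β f) := by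
  have hint := hX.integrable_comp hlam hmu hf
  obtain ⟨C, b, hb, hfC⟩ := hf
  have hb₂ : 1 ≤ 2 * b := by linarith
  let F (N : ℕ) : State m → ℝ := {z | size z < N}.indicator f
  have hFC (N z) : |F N z| ≤ C * b ^ size z :=
    (norm_indicator_le_norm_self f z).trans (hfC z)
  have hF (z) : ∀ᶠ N in atTop, F N z = f z := by
    filter_upwards [eventually_gt_atTop (size z)] with N hN
    exact Set.indicator_of_mem (s := {z | size z < N}) hN f
  have hGF (z) : ∀ᶠ N in atTop, M.generator β (F N) z = M.generator β f z := by
    filter_upwards [eventually_gt_atTop (size z + 1)] with N hN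
    exact Model.generator_congr fun w hw _ =>
      Set.indicator_of_mem (s := {z | size z < N}) (hw.trans_lt hN) f
  have hbound (N u) := hX.abs_meanAt_le hlam hmu hb₂ (M.abs_generator_le (β := β) hb (hFC N)) u
  have hbound_cont := (by fun_prop : Continuous fun u : ℝ =>
    Real.exp ((∑ i, M.lam i) * (2 * b - 1) * max u 0) * (2 * b) ^ size ((0, y₀) : State m))
  refine ⟨hint, hX.intervalIntegrable_meanAt (hbound_cont.const_mul _)
    (hX.abs_meanAt_le hlam hmu hb₂ (M.abs_generator_le hb hfC)), fun t ht => ?_⟩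
  have hright : Tendsto (fun N => ∫ u in 0..t, meanAt P X (M.generator β (F N)) u) atTop
      (𝓝 (∫ u in 0..t, meanAt P X (M.generator β f) u)) :=
    intervalIntegral.tendsto_integral_filter_of_dominated_convergence _
      (.of_forall fun N => (hX.measurable_meanAt _).aestronglyMeasurable)
      (.of_forall fun N => .of_forall fun u _ => hbound N u)
      ((hbound_cont.const_mul _).intervalIntegrable 0 t)
      (.of_forall fun u _ => hX.tendsto_meanAt hlam hmu hb₂
        (fun N => M.abs_generator_le hb (hFC N)) hGF u)
  refine tendsto_nhds_unique (hX.tendsto_meanAt hlam hmu hb hFC hF t)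
    (((tendsto_nhds_of_eventually_eq (hF (0, y₀))).add hright).congr fun N => ?_)
  refine ((hX.dynkinFormula_of_finite_support ?_).meanAt_eq t ht).symm
  exact (finite_setOf_size_lt N).subset Set.support_indicator_subset

lemma integral_le_of_generator_le (hf : ExpGrowth f) {a c : ℝ}
    (hdrift : ∀ z, M.generator β f z ≤ c * (a - f z)) (t : ℝ≥0) :
    ∫ ω, f (X t ω) ∂P ≤ a + Real.exp (-(c * t)) * (f (0, y₀) - a) :=
  (hX.dynkinFormula hlam hmu hf).integral_le_of_le (hX.dynkinFormula hlam hmu hf.generator) hdrift t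

end ExpGrowth

end IsPenaltyProcess

section Mean

lemma Model.Dneg_nonneg (M : Model m s) (j : Fin s) (i : Fin m) : 0 ≤ M.Dneg j i :=
  le_max_right _ _

lemma Model.Dpos_nonneg (M : Model m s) (j : Fin s) (i : Fin m) : 0 ≤ M.Dpos j i :=
  le_max_right _ _

lemma Model.cap_pos {M : Model m s}
    (hint : ∃ x ∈ M.targetSet, ∀ j, ∑ i, M.D j i * x i < M.h j) (j : Fin s) : 0 < M.cap j := by
  obtain ⟨x, ⟨hx, -⟩, hlt⟩ := hint
  calc 0 ≤ ∑ i, (M.Dpos j i * x i + M.Dneg j i * (M.load i - x i)) :=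
        Finset.sum_nonneg fun i _ => add_nonneg (mul_nonneg (M.Dpos_nonneg j i) (hx i).1)
          (mul_nonneg (M.Dneg_nonneg j i) (sub_nonneg.2 (hx i).2))
    _ = ∑ i, M.D j i * x i + ∑ i, M.Dneg j i * M.load i := by
        rw [← Finset.sum_add_distrib]
        refine Finset.sum_congr rfl fun i _ => ?_
        rw [← M.Dpos_sub_Dneg j i]
        ring
    _ < M.cap j := add_lt_add_left (hlt j) _

lemma Model.sum_D_mul_le {M : Model m s} {j : Fin s} {ζ : ℝ} {x y r : Fin m → ℝ}
    (hcap : 0 < M.cap j) (hratio : M.ratio j x y ≤ 1 + ζ) (hr : ∀ i, M.load i - r i ≤ x i + y i) :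
    ∑ i, M.D j i * x i ≤ M.h j + ζ * M.cap j + ∑ i, M.Dneg j i * r i := by
  have hlifted : ∑ i, M.Dpos j i * x i + ∑ i, M.Dneg j i * y i ≤ (1 + ζ) * M.cap j :=
    (div_le_iff₀ hcap).1 hratio
  have hload : ∑ i, M.Dneg j i * (M.load i - r i) ≤ ∑ i, M.Dneg j i * (x i + y i) :=
    Finset.sum_le_sum fun i _ => mul_le_mul_of_nonneg_left (hr i) (M.Dneg_nonneg j i)
  simp only [mul_sub, mul_add, Finset.sum_sub_distrib, Finset.sum_add_distrib] at hload
  simp only [← M.Dpos_sub_Dneg, sub_mul, Finset.sum_sub_distrib]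
  rw [cap] at hlifted ⊢
  linarith

lemma le_add_log_div_of_exp_mul_le {β r c n : ℝ} (hβ : 0 < β) (hn : 0 < n)
    (h : Real.exp (β * r) ≤ n * Real.exp (β * c)) : r ≤ c + Real.log n / β := by
  have hlog : β * r ≤ Real.log n + β * c := by
    rwa [← Real.exp_le_exp, Real.exp_add, Real.exp_log hn]
  rw [← sub_le_iff_le_add', le_div_iff₀ hβ]
  linarith

namespace IsPenaltyProcess

variable {M : Model m s} {β ε : ℝ} {y₀ : Fin m → ℕ} {Ω : Type*} [mΩ : MeasurableSpace Ω]
  {P : Measure Ω} [IsProbabilityMeasure P] {ℱ : Filtration ℝ≥0 mΩ} {X : ℝ≥0 → Ω → State m}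

lemma load_sub_exp_mul_le (hX : IsPenaltyProcess M β y₀ P ℱ X) (hlam : ∀ i, 0 ≤ M.lam i)
    (hmu : ∀ i, 0 < M.mu i) (t : ℝ≥0) (i : Fin m) :
    M.load i - Real.exp (-(M.mu i * t)) * (M.load i - y₀ i) ≤
      ∫ ω, ((X t ω).1 i : ℝ) ∂P + ∫ ω, ((X t ω).2 i : ℝ) ∂P := by
  have hmu' (l) : 0 ≤ M.mu l := (hmu l).le
  have hcount := hX.integral_le_of_generator_le hlam hmu' (expGrowth_classCount i).neg
    (a := -M.load i) (c := M.mu i) (fun z => by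
      rw [Model.generator_neg, Model.generator_classCount, Model.load]
      have := (hmu i).ne'
      exact le_of_eq (by field_simp; ring)) t
  have hsum : ∫ ω, classCount i (X t ω) ∂P =
      ∫ ω, ((X t ω).1 i : ℝ) ∂P + ∫ ω, ((X t ω).2 i : ℝ) ∂P :=
    integral_add (hX.integrable_comp hlam hmu' (expGrowth_stateVec (.inl i)) t)
      (hX.integrable_comp hlam hmu' (expGrowth_stateVec (.inr i)) t)
  have hinitial : classCount i ((0, y₀) : State m) = y₀ i := by simp [classCount, stateVec]
  rw [integral_neg, hsum, hinitial] at hcount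
  linarith

lemma integral_statePenalty_le_penaltyLevel [NeZero m] (hX : IsPenaltyProcess M β y₀ P ℱ X)
    (hlam : ∀ i, 0 ≤ M.lam i) (hmu : ∀ i, 0 < M.mu i) (hε₀ : 0 ≤ ε) (hε : ε ≤ 1 / 3)
    (hW : ∀ j k, M.penaltyMatrix β j k ∈ Set.Icc 0 ε) {p : (Fin m → ℝ) × (Fin m → ℝ)}
    (hp₁ : 0 ≤ p.1) (hp₂ : 0 ≤ p.2) (hload : ∀ i, M.load i ≤ p.1 i + p.2 i)
    (hinit : M.penalty β 0 (fun i => (y₀ i : ℝ)) ≤ M.penaltyLevel β ε p) (t : ℝ≥0) :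
    ∫ ω, M.statePenalty β (X t ω) ∂P ≤ M.penaltyLevel β ε p := by
  have hdecay := hX.integral_le_of_generator_le hlam (fun i => (hmu i).le)
    (M.expGrowth_statePenalty (hε.trans (by norm_num)) hW)
    (M.generator_statePenalty_le_mul_penaltyLevel_sub hlam hmu hε₀ hε hW hp₁ hp₂ hload) t
  have hstart : M.statePenalty β (0, y₀) ≤ M.penaltyLevel β ε p := by
    refine le_of_eq_of_le ?_ hinit
    rw [Model.penalty_eq, Model.statePenalty, stateVec]
    congr 2
    exact funext fun _ => Nat.cast_zero
  exact hdecay.trans (add_le_of_nonpos_right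
    (mul_nonpos_of_nonneg_of_nonpos (Real.exp_pos _).le (sub_nonpos.2 hstart)))

lemma exp_mul_ratio_integral_le (hX : IsPenaltyProcess M β y₀ P ℱ X) (hlam : ∀ i, 0 ≤ M.lam i)
    (hmu : ∀ i, 0 ≤ M.mu i) (hε : ε ≤ 1) (hW : ∀ j k, M.penaltyMatrix β j k ∈ Set.Icc 0 ε)
    (t : ℝ≥0) (j : Fin s) :
    Real.exp (β * M.ratio j (fun i => ∫ ω, ((X t ω).1 i : ℝ) ∂P)
      (fun i => ∫ ω, ((X t ω).2 i : ℝ) ∂P)) ≤ ∫ ω, M.statePenalty β (X t ω) ∂P := by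
  have hmean : (fun k => ∫ ω, stateVec (X t ω) k ∂P) =
      Sum.elim (fun i => ∫ ω, ((X t ω).1 i : ℝ) ∂P) (fun i => ∫ ω, ((X t ω).2 i : ℝ) ∂P) := by
    ext (i | i) <;> rfl
  rw [← Model.penaltyMatrix_mulVec, ← hmean]
  exact (exp_mulVec_le_expSum (M.penaltyMatrix β) _ j).trans
    (expSum_integral_le (M.penaltyMatrix β)
      (fun k => hX.integrable_comp hlam hmu (expGrowth_stateVec k) t)
      (hX.integrable_comp hlam hmu (M.expGrowth_statePenalty hε hW) t))

end IsPenaltyProcess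

end Mean

end PolytopicTarget

open PolytopicTarget in
theorem theorem9_general {m s : ℕ} [NeZero m]
    (M : PolytopicTarget.Model m s)
    (hlam : ∀ i, 0 ≤ M.lam i) (hmu : ∀ i, 0 < M.mu i) (hcap : ∀ j, 0 < M.cap j)
    (ε β : ℝ) (hε₀ : 0 ≤ ε) (hε : ε ≤ 1 / 3)
    (hβ₀ : 0 < β) (hβ : ∀ j i, β * |M.D j i| ≤ ε * M.cap j)
    (p : (Fin m → ℝ) × (Fin m → ℝ)) (hp₁ : 0 ≤ p.1) (hp₂ : 0 ≤ p.2)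
    (hload : ∀ i, M.load i ≤ p.1 i + p.2 i)
    (hrates : M.violation p ≤ M.muMin / M.muMax)
    (y₀ : Fin m → ℕ)
    (hinit : M.penalty β 0 (fun i => (y₀ i : ℝ)) ≤ M.penaltyLevel β ε p)
    {Ω : Type*} [mΩ : MeasurableSpace Ω] (P : Measure Ω) [IsProbabilityMeasure P]
    (ℱ : Filtration ℝ≥0 mΩ) (X : ℝ≥0 → Ω → PolytopicTarget.State m)
    (hX : PolytopicTarget.IsPenaltyProcess M β y₀ P ℱ X) (t : ℝ≥0) :
    (∀ i, Integrable (fun ω => ((X t ω).1 i : ℝ)) P) ∧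
    ∀ j, ∑ i, M.D j i * ∫ ω, ((X t ω).1 i : ℝ) ∂P ≤
      M.h j + (Real.log s / β + 3 * ε) * (M.h j + ∑ i, M.Dneg j i * M.load i)
        + ∑ i, M.Dneg j i * Real.exp (-(M.mu i * t)) * (M.load i - y₀ i) := by
  have hmu' (i) : 0 ≤ M.mu i := (hmu i).le
  have hW := M.penaltyMatrix_mem_Icc hcap hβ₀.le hβ
  refine ⟨fun i => hX.integrable_comp hlam hmu' (expGrowth_stateVec (.inl i)) t, fun j => ?_⟩
  have hpenalty := (hX.exp_mul_ratio_integral_le hlam hmu' (by linarith) hW t j).trans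
    ((hX.integral_statePenalty_le_penaltyLevel hlam hmu hε₀ hε hW hp₁ hp₂ hload hinit t).trans
      (M.penaltyLevel_le hmu hε₀ hβ₀.le hrates))
  have hratio := le_add_log_div_of_exp_mul_le hβ₀ (Nat.cast_pos.2 j.pos) hpenalty
  have hbound := Model.sum_D_mul_le (ζ := Real.log s / β + 3 * ε) (hcap j)
    (hratio.trans_eq (by ring)) (hX.load_sub_exp_mul_le hlam hmu t)
  simpa only [Model.cap, mul_assoc] using hbound

theorem theorem9 {m s : ℕ} [NeZero m] [NeZero s]
    (M : PolytopicTarget.Model m s)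
    (hlam : ∀ i, 0 < M.lam i) (hmu : ∀ i, 0 < M.mu i) (hh : ∀ j, 0 ≤ M.h j)
    (hint : ∃ x ∈ M.targetSet, ∀ j, ∑ i, M.D j i * x i < M.h j)
    (ε β : ℝ) (hε₀ : 0 < ε) (hε : ε < 1 / 4)
    (hβ₀ : 0 < β) (hβ : ∀ j i, β * |M.D j i| ≤ ε * M.cap j)
    (p : (Fin m → ℝ) × (Fin m → ℝ)) (hp : p ∈ M.liftedSet)
    (hmin : IsMinOn M.violation M.liftedSet p)
    (hrates : M.violation p ≤ M.muMin / M.muMax)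
    (y₀ : Fin m → ℕ)
    (hinit : M.penalty β 0 (fun i => (y₀ i : ℝ)) ≤ M.penaltyLevel β ε p)
    {Ω : Type*} [mΩ : MeasurableSpace Ω] (P : Measure Ω) [IsProbabilityMeasure P]
    (ℱ : Filtration ℝ≥0 mΩ) (X : ℝ≥0 → Ω → PolytopicTarget.State m)
    (hX : PolytopicTarget.IsPenaltyProcess M β y₀ P ℱ X) (t : ℝ≥0) :
    (∀ i, Integrable (fun ω => ((X t ω).1 i : ℝ)) P) ∧
    ∀ j, ∑ i, M.D j i * ∫ ω, ((X t ω).1 i : ℝ) ∂P ≤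
      M.h j + (Real.log s / β + 3 * ε) * (M.h j + ∑ i, M.Dneg j i * M.load i)
        + ∑ i, M.Dneg j i * Real.exp (-(M.mu i * t)) * (M.load i - y₀ i) := by
  exact theorem9_general M (fun i => (hlam i).le) hmu (M.cap_pos hint) ε β hε₀.le (by linarith) hβ₀
    hβ p (fun i => (hp.1 i).1) (fun i => (hp.2.1 i).1) hp.2.2.1 hrates y₀ hinit P ℱ X hX t
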